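/- All graphs are finite and simple. An $(n,m)$-graph is a graph with vertex set $\{1,\dots,n\}$ and exactly $m$ edges. Let $\mathcal F$ be a family of graphs. An $\mathcal F$-graph is a graph isomorphic to a member of $\mathcal F$, and an $\mathcal F$-subgraph of $G$ is a (not necessarily induced) subgraph of $G$, i.e. a subset of the vertices together with a subset of the edges of $G$ among them, that is an $\mathcal F$-graph. Let $\mathcal F_{n,m}$ be the number of $(n,m)$-graphs that are $\mathcal F$-graphs, and let $$F(z,w)=\sum_{n,m\ge 0}\mathcal F_{n,m}\,w^m\,\frac{z^n}{n!}.$$ Let $D_{n,m}$ be the number of $(n,m)$-graphs where one $\mathcal F$-subgraph is distinguished, that is, the number of pairs $(G,S)$ where $G$ is an $(n,m)$-graph and $S$ is an $\mathcal F$-subgraph of $G$. (1) For all $n,m\ge 0$, as an identity on coefficients of formal power series, $$D_{n,m}=n!\,[z^n w^m]\;F\!\left(z,\frac{w}{1+w}\right)e^{z}(1+w)^{\binom n2}.$$ (2) Let $m=m(n)$ be a sequence of non-negative integers with $m\to\infty$ and $m=o(n^2)$ as $n\to\infty$. Assume that $F$ is entire, i.e. its series converges at every point of $\mathbb C^2$,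 and that the functions $$(z,w)\longmapsto \frac{F\!\left(nz,\;mw/\binom n2\right)}{F\!\left(n,\;m/\binom n2\right)}$$ converge, as $n\to\infty$, uniformly on every compact subset of $\mathbb C^2$ to an analytic function on $\mathbb C^2$. Then, as $n\to\infty$, $$D_{n,m}\sim\binom{\binom n2}{m}\,F\!\left(n,\frac{m}{\binom n2}\right),$$ where $a_n\sim b_n$ means $a_n-b_n=o(b_n)$. -/

import Mathlib

open Filter Asymptotics
open scoped Nat

namespace SubgraphCount

noncomputable section

/-- A family of finite graphs, given by representatives on the vertex sets `Fin k`. It need not be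
closed under isomorphism. -/
abbrev GraphFamily : Type := Set (Σ k : ℕ, SimpleGraph (Fin k))

/-- `H` is an `𝓕`-graph: it is isomorphic to some member of the family `𝓕`. -/
def IsFamilyGraph (𝓕 : GraphFamily) {V : Type*} (H : SimpleGraph V) : Prop :=
  ∃ F ∈ 𝓕, Nonempty (H ≃g F.2)

/-- An `(n,m)`-graph: a simple graph on `n` labelled vertices with exactly `m` edges. -/
abbrev NMGraph (n m : ℕ) : Type := {G : SimpleGraph (Fin n) // G.edgeSet.ncard = m}

/-- `𝓕_{n,m}`: the number of `(n,m)`-graphs isomorphic to a graph from `𝓕`. -/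
def familyCount (𝓕 : GraphFamily) (n m : ℕ) : ℕ :=
  Nat.card {H : NMGraph n m // IsFamilyGraph 𝓕 H.1}

/-- The number of `(n,m)`-graphs where one `𝓕`-subgraph is distinguished: the number of pairs
`(G, S)` of an `(n,m)`-graph `G` and a subgraph `S` of `G` that is an `𝓕`-graph. -/
def distinguishedCount (𝓕 : GraphFamily) (n m : ℕ) : ℕ :=
  Nat.card (Σ G : NMGraph n m, {S : G.1.Subgraph // IsFamilyGraph 𝓕 S.coe})

/-- The formal variable `z`. -/
def varZ : MvPowerSeries (Fin 2) ℚ := MvPowerSeries.X 0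

/-- The formal variable `w`. -/
def varW : MvPowerSeries (Fin 2) ℚ := MvPowerSeries.X 1

/-- The coefficient extraction `[z^n w^m]`. -/
def coeffZW (n m : ℕ) (A : MvPowerSeries (Fin 2) ℚ) : ℚ :=
  MvPowerSeries.coeff (Finsupp.single 0 n + Finsupp.single 1 m) A

/-- The generating function `F(z,w) = ∑ 𝓕_{n,m} w^m z^n / n!`, as a formal power series. -/
def genSeries (𝓕 : GraphFamily) : MvPowerSeries (Fin 2) ℚ :=
  fun d => (familyCount 𝓕 (d 0) (d 1) : ℚ) / ((d 0)! : ℚ)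

/-- The formal power series `F(z, w/(1+w)) e^z (1+w)^N`. -/
def distinguishedSeries (𝓕 : GraphFamily) (N : ℕ) : MvPowerSeries (Fin 2) ℚ :=
  MvPowerSeries.subst ![varZ, varW * (1 + varW)⁻¹] (genSeries 𝓕)
    * PowerSeries.subst varZ (PowerSeries.exp ℚ)
    * (1 + varW) ^ N

/-- The term `𝓕_{n,m} w^m z^n / n!`, `p = (n,m)`, at complex arguments. -/
def genTerm (𝓕 : GraphFamily) (z w : ℂ) (p : ℕ × ℕ) : ℂ :=
  (familyCount 𝓕 p.1 p.2 : ℂ) * w ^ p.2 * (z ^ p.1 / (p.1 ! : ℂ))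

/-- The series `F(z,w)` defines an entire function of two complex variables: it converges
(absolutely) at every point of `ℂ²`. -/
def IsEntire (𝓕 : GraphFamily) : Prop :=
  ∀ z w : ℂ, Summable (genTerm 𝓕 z w)

/-- The value `F(z,w)` of the generating function at complex arguments. -/
def genFun (𝓕 : GraphFamily) (z w : ℂ) : ℂ :=
  ∑' p : ℕ × ℕ, genTerm 𝓕 z w p

/-- `m / C(n,2)` as a complex number. -/
def edgeRatio (n m : ℕ) : ℂ := (m : ℂ) / (n.choose 2 : ℂ)

/-- The rescaled ratio `F(nz, mw/C(n,2)) / F(n, m/C(n,2))`, with `p = (z,w)`. -/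
def rescaledRatio (𝓕 : GraphFamily) (n m : ℕ) (p : ℂ × ℂ) : ℂ :=
  genFun 𝓕 ((n : ℂ) * p.1) (edgeRatio n m * p.2) / genFun 𝓕 (n : ℂ) (edgeRatio n m)

end

end SubgraphCount

/-! A pair $(G,S)$ amounts to a vertex set of size $k$, an $\mathcal F$-graph on it with $j$ edges,
and an $m$-edge graph $G$ containing it. With $N=\binom n2$ this gives $D_{n,m}=\sum_{k,j}\binom
nk\mathcal F_{k,j}\binom{N-j}{m-j}$ over $j\le m$ (`distinguishedCount_eq_sum`). Part (1) reads this
off from $(w/(1+w))^j(1+w)^N=w^j(1+w)^{N-j}$ and $n!/(k!\,(n-k)!)=\binom nk$.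

For part (2), each summand is compared with $\binom Nm$ times the corresponding term of $F(n,m/N)$.
It is never larger (`pairCount_le`), and its relative deficit is at most
$k^2/n+j^2/m\le(2/n+2/m)2^k2^j$ (`le_pairCount`). The factor $2^k2^j$ turns a term of $F(n,m/N)$
into one of $F(2n,2m/N)$, so the total relative error is at most $2/n+2/m$ times the rescaled ratio
at $(2,2)$, which converges by hypothesis. -/

namespace SubgraphCount

/-! ### Double counting by the distinguished subgraph -/

/-- The number of graphs with `m` edges containing a given graph on the same vertex set. -/
theorem card_supergraphs {V : Type*} [Fintype V] (H : SimpleGraph V) (m : ℕ) :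
    Nat.card {G : {G : SimpleGraph V // G.edgeSet.ncard = m} // H ≤ G.1} =
      if H.edgeSet.ncard ≤ m then
        ((Fintype.card V).choose 2 - H.edgeSet.ncard).choose (m - H.edgeSet.ncard) else 0 := by
  classical
  have hn : ∀ G : SimpleGraph V, G.edgeSet.ncard = G.edgeFinset.card := fun G => by
    rw [← SimpleGraph.coe_edgeFinset, Set.ncard_coe_finset]
  split_ifs with h
  · set T := (⊤ : SimpleGraph V).edgeFinset \ H.edgeFinset with hT
    have hTc : T.card = (Fintype.card V).choose 2 - H.edgeSet.ncard := by
      rw [hT, Finset.card_sdiff_of_subset (SimpleGraph.edgeFinset_mono le_top),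
        SimpleGraph.card_edgeFinset_top_eq_card_choose_two, hn]
    rw [← hTc, ← Finset.card_powersetCard, ← Fintype.card_coe, ← Nat.card_eq_fintype_card]
    refine Nat.card_eq_of_bijective (fun G => ⟨G.1.1.edgeFinset \ H.edgeFinset, ?_⟩) ⟨?_, ?_⟩
    · rw [Finset.mem_powersetCard, Finset.card_sdiff_of_subset (SimpleGraph.edgeFinset_mono G.2),
        ← hn, ← hn, G.1.2]
      exact ⟨Finset.sdiff_subset_sdiff (SimpleGraph.edgeFinset_mono le_top) le_rfl, rfl⟩
    · rintro ⟨⟨G, hG⟩, hle⟩ ⟨⟨G', hG'⟩, hle'⟩ heq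
      simp only [Subtype.mk.injEq] at heq ⊢
      rw [← SimpleGraph.edgeFinset_inj,
        ← Finset.sdiff_union_of_subset (SimpleGraph.edgeFinset_mono hle), heq,
        Finset.sdiff_union_of_subset (SimpleGraph.edgeFinset_mono hle')]
    · rintro ⟨s, hs⟩
      rw [Finset.mem_powersetCard] at hs
      have hdisj : Disjoint s H.edgeFinset :=
        Finset.disjoint_of_subset_left hs.1 Finset.sdiff_disjoint
      -- `fromEdgeSet` discards loops, so recovering the edge set requires that none of the chosen
      -- pairs is diagonal.
      have hE : (SimpleGraph.fromEdgeSet (↑(s ∪ H.edgeFinset) : Set (Sym2 V))).edgeSet =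
          ↑(s ∪ H.edgeFinset) := by
        rw [SimpleGraph.edgeSet_fromEdgeSet, sdiff_eq_left, Set.disjoint_left]
        intro e he
        rw [Finset.mem_coe, Finset.mem_union] at he
        have : e ∈ (⊤ : SimpleGraph V).edgeFinset := by
          rcases he with he | he
          · exact (Finset.mem_sdiff.1 (hs.1 he)).1
          · exact SimpleGraph.edgeFinset_mono le_top he
        rw [SimpleGraph.mem_edgeFinset, SimpleGraph.edgeSet_top] at this
        exact this
      refine ⟨⟨⟨SimpleGraph.fromEdgeSet ↑(s ∪ H.edgeFinset), ?_⟩, ?_⟩, ?_⟩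
      · rw [hE, Set.ncard_coe_finset, Finset.card_union_of_disjoint hdisj, hs.2, hn]
        rw [hn] at h
        omega
      · rw [← SimpleGraph.edgeSet_subset_edgeSet, hE, Finset.coe_union,
          SimpleGraph.coe_edgeFinset]
        exact Set.subset_union_right
      · ext1
        rw [← Finset.coe_inj, Finset.coe_sdiff, SimpleGraph.coe_edgeFinset]
        change (SimpleGraph.fromEdgeSet _).edgeSet \ _ = _
        rw [hE, ← Finset.coe_sdiff, Finset.union_sdiff_cancel_right hdisj]
  · rw [Nat.card_eq_zero]
    left
    constructor
    rintro ⟨⟨G, hG⟩, hle⟩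
    apply h
    rw [← hG]
    exact Set.ncard_le_ncard (SimpleGraph.edgeSet_mono hle)

/-- The subgraph of `G` spanned by the edges of a graph on a set of vertices. -/
def subgraphOfLE {V : Type*} {G : SimpleGraph V} (s : Set V) (H : SimpleGraph s)
    (h : H.map (Function.Embedding.subtype (· ∈ s)) ≤ G) : G.Subgraph where
  verts := s
  Adj := (H.map (Function.Embedding.subtype (· ∈ s))).Adj
  adj_sub h' := h h'
  edge_vert := by
    rintro v w ⟨_, a, b, _, rfl, _⟩
    exact a.2
  symm := (H.map (Function.Embedding.subtype (· ∈ s))).symm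

theorem coe_subgraphOfLE {V : Type*} {G : SimpleGraph V} (s : Set V) (H : SimpleGraph s)
    (h : H.map (Function.Embedding.subtype (· ∈ s)) ≤ G) : (subgraphOfLE s H h).coe = H := by
  ext a b
  exact SimpleGraph.map_adj_apply

/-- Pairs of a graph and a family subgraph, regrouped by vertex set and graph of the subgraph. -/
def distinguishedEquiv (𝓕 : GraphFamily) (n m : ℕ) :
    (Σ G : NMGraph n m, {S : G.1.Subgraph // IsFamilyGraph 𝓕 S.coe}) ≃
      Σ V : Set (Fin n), Σ H : {H : SimpleGraph V // IsFamilyGraph 𝓕 H},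
        {G : NMGraph n m // H.1.map (Function.Embedding.subtype (· ∈ V)) ≤ G.1} where
  toFun p := ⟨p.2.1.verts, ⟨p.2.1.coe, p.2.2⟩, ⟨p.1, by
    rw [SimpleGraph.map_le_iff_le_comap]
    intro a b hab
    exact p.2.1.adj_sub hab⟩⟩
  invFun q := ⟨q.2.2.1, ⟨subgraphOfLE q.1 q.2.1.1 q.2.2.2, by
    rw [coe_subgraphOfLE]
    exact q.2.1.2⟩⟩
  left_inv := by
    rintro ⟨G, S, hS⟩
    refine Sigma.ext rfl (heq_of_eq (Subtype.ext (SimpleGraph.Subgraph.ext rfl ?_)))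
    ext a b
    refine (SimpleGraph.map_adj _ _ _ _).trans ⟨?_, fun h => ?_⟩
    · rintro ⟨a, b, h, rfl, rfl⟩
      exact h
    · exact ⟨⟨a, S.edge_vert h⟩, ⟨b, S.edge_vert h.symm⟩, h, rfl, rfl⟩
  right_inv := by
    rintro ⟨V, ⟨H, hH⟩, ⟨G, hG⟩⟩
    -- `H` is recovered only up to a propositional equality on which later components depend;
    -- generalising over `H'` lets it be substituted away.
    have key : ∀ (H' : SimpleGraph V) (_ : H' = H) (p : IsFamilyGraph 𝓕 H')
        (q : H'.map (Function.Embedding.subtype (· ∈ V)) ≤ G.1),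
        (⟨V, ⟨H', p⟩, ⟨G, q⟩⟩ : Σ V : Set (Fin n), Σ H : {H : SimpleGraph V // IsFamilyGraph 𝓕 H},
          {G : NMGraph n m // H.1.map (Function.Embedding.subtype (· ∈ V)) ≤ G.1}) =
        ⟨V, ⟨H, hH⟩, ⟨G, hG⟩⟩ := by
      rintro _ rfl _ _
      rfl
    exact key _ (coe_subgraphOfLE V H hG) _ _

theorem ncard_edgeSet_congr {V W : Type*} {G : SimpleGraph V} {H : SimpleGraph W} (e : G ≃g H) :
    G.edgeSet.ncard = H.edgeSet.ncard :=
  Nat.card_congr e.mapEdgeSet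

theorem isFamilyGraph_congr {𝓕 : GraphFamily} {V W : Type*} {G : SimpleGraph V}
    {H : SimpleGraph W} (e : G ≃g H) : IsFamilyGraph 𝓕 G ↔ IsFamilyGraph 𝓕 H := by
  constructor
  · rintro ⟨F, hF, ⟨f⟩⟩
    exact ⟨F, hF, ⟨e.symm.trans f⟩⟩
  · rintro ⟨F, hF, ⟨f⟩⟩
    exact ⟨F, hF, ⟨e.trans f⟩⟩

/-- Being an $\mathcal F$-graph and the edge number are isomorphism invariants, so both transport
along any numbering of `V`. -/
theorem card_familyGraphs (𝓕 : GraphFamily) {V : Type*} [Finite V] (j : ℕ) :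
    Nat.card {H : {H : SimpleGraph V // IsFamilyGraph 𝓕 H} // H.1.edgeSet.ncard = j} =
      familyCount 𝓕 (Nat.card V) j := by
  let e := (Finite.equivFin V).symm
  refine Nat.card_congr ((Equiv.subtypeSubtypeEquivSubtypeInter (IsFamilyGraph 𝓕)
    fun H : SimpleGraph V => H.edgeSet.ncard = j).trans (Equiv.trans ?_
    (Equiv.subtypeSubtypeEquivSubtypeInter (fun H => H.edgeSet.ncard = j)
      (IsFamilyGraph 𝓕)).symm))
  refine Equiv.subtypeEquiv e.symm.simpleGraph fun H => ?_
  have i : e.symm.simpleGraph H ≃g H := SimpleGraph.Iso.comap e H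
  rw [isFamilyGraph_congr i, ncard_edgeSet_congr i, and_comm]

theorem ncard_edgeSet_le {V : Type*} [Finite V] (H : SimpleGraph V) :
    H.edgeSet.ncard ≤ (Nat.card V).choose 2 := by
  classical
  have := Fintype.ofFinite V
  rw [← SimpleGraph.coe_edgeFinset, Set.ncard_coe_finset, Nat.card_eq_fintype_card]
  exact SimpleGraph.card_edgeFinset_le_card_choose_two

theorem familyCount_eq_zero (𝓕 : GraphFamily) {n j : ℕ} (h : n.choose 2 < j) :
    familyCount 𝓕 n j = 0 := by
  rw [familyCount, Nat.card_eq_zero]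
  left
  constructor
  rintro ⟨⟨H, hH⟩, -⟩
  have := ncard_edgeSet_le H
  rw [Nat.card_fin] at this
  omega

/-- The number of graphs with `m` edges out of `N` possible ones that contain `j` given edges. -/
def extensionCount (N m j : ℕ) : ℕ := if j ≤ m then (N - j).choose (m - j) else 0

/-- The number of $m$-edge supergraphs depends only on the edge number of `H`, so the sum is grouped
by it. The range of `j` is taken independent of `V`, so that the result depends on `V` only through
its size. -/
theorem card_extensions (𝓕 : GraphFamily) (n m : ℕ) (V : Set (Fin n)) :
    Nat.card (Σ H : {H : SimpleGraph V // IsFamilyGraph 𝓕 H},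
        {G : NMGraph n m // H.1.map (Function.Embedding.subtype (· ∈ V)) ≤ G.1}) =
      ∑ j ∈ Finset.range (n.choose 2 + 1),
        familyCount 𝓕 (Nat.card V) j * extensionCount (n.choose 2) m j := by
  classical
  have := Fintype.ofFinite {H : SimpleGraph V // IsFamilyGraph 𝓕 H}
  rw [Nat.card_sigma]
  have h1 : ∀ H : {H : SimpleGraph V // IsFamilyGraph 𝓕 H},
      Nat.card {G : NMGraph n m // H.1.map (Function.Embedding.subtype (· ∈ V)) ≤ G.1} =
        extensionCount (n.choose 2) m H.1.edgeSet.ncard := by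
    intro H
    rw [card_supergraphs, Fintype.card_fin, SimpleGraph.edgeSet_map,
      Set.ncard_image_of_injective _ (Function.Embedding.injective _), extensionCount]
  rw [Finset.sum_congr rfl fun H _ => h1 H, ← Finset.sum_fiberwise_of_maps_to
    (t := Finset.range (n.choose 2 + 1)) (g := fun H => H.1.edgeSet.ncard)]
  · refine Finset.sum_congr rfl fun j _ => ?_
    rw [Finset.sum_congr rfl (g := fun _ => extensionCount (n.choose 2) m j)
      fun H hH => by rw [(Finset.mem_filter.1 hH).2]]
    rw [Finset.sum_const, smul_eq_mul, ← card_familyGraphs, Nat.card_eq_fintype_card,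
      Fintype.card_subtype]
  · intro H _
    rw [Finset.mem_range, Nat.lt_succ_iff]
    refine (ncard_edgeSet_le H.1).trans (Nat.choose_le_choose 2 ?_)
    simpa using Finite.card_subtype_le (· ∈ V)

/-- The number of distinguished pairs, by vertex and edge number of the subgraph. -/
theorem distinguishedCount_eq_sum (𝓕 : GraphFamily) (n m : ℕ) :
    distinguishedCount 𝓕 n m = ∑ k ∈ Finset.range (n + 1), ∑ j ∈ Finset.range (n.choose 2 + 1),
      n.choose k * (familyCount 𝓕 k j * extensionCount (n.choose 2) m j) := by
  classical
  rw [distinguishedCount, Nat.card_congr (distinguishedEquiv 𝓕 n m), Nat.card_sigma,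
    Finset.sum_congr rfl fun V _ => card_extensions 𝓕 n m V]
  have h := Finset.sum_powerset_apply_card (fun k => ∑ j ∈ Finset.range (n.choose 2 + 1),
    familyCount 𝓕 k j * extensionCount (n.choose 2) m j) (x := (Finset.univ : Finset (Fin n)))
  rw [Finset.card_fin] at h
  simp only [smul_eq_mul, Finset.mul_sum] at h
  rw [← h, Finset.powerset_univ]
  refine (Fintype.sum_equiv Fintype.finsetEquivSet _ _ fun s => ?_).symm
  simp

/-! ### Coefficient extraction -/

open MvPowerSeries in
theorem hasSubst_varZ_varW : HasSubst ![varZ, varW * (1 + varW)⁻¹] := by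
  refine hasSubst_of_constantCoeff_zero fun i => ?_
  fin_cases i <;> simp [varZ, varW]

/-- The exponent vector of `z^k w^j`. -/
noncomputable def expZW (k j : ℕ) : Fin 2 →₀ ℕ := Finsupp.single 0 k + Finsupp.single 1 j

@[simp] theorem expZW_zero (k j : ℕ) : expZW k j 0 = k := by simp [expZW]

@[simp] theorem expZW_one (k j : ℕ) : expZW k j 1 = j := by simp [expZW]

theorem expZW_apply_eq (d : Fin 2 →₀ ℕ) : expZW (d 0) (d 1) = d := by
  ext i
  fin_cases i <;> simp

theorem coeffZW_eq (n m : ℕ) (A : MvPowerSeries (Fin 2) ℚ) :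
    coeffZW n m A = MvPowerSeries.coeff (expZW n m) A := rfl

theorem varZ_pow_mul_varW_pow (k j : ℕ) :
    varZ ^ k * varW ^ j = MvPowerSeries.monomial (expZW k j) 1 := by
  rw [varZ, varW, MvPowerSeries.X_pow_eq, MvPowerSeries.X_pow_eq,
    MvPowerSeries.monomial_mul_monomial, one_mul, expZW]

theorem expZW_le_iff {k j n m : ℕ} : expZW k j ≤ expZW n m ↔ k ≤ n ∧ j ≤ m := by
  rw [Finsupp.le_def, Fin.forall_fin_two]
  simp

theorem expZW_sub (k j n m : ℕ) : expZW n m - expZW k j = expZW (n - k) (m - j) := by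
  ext i
  fin_cases i <;> simp

theorem coeffZW_pow_mul (k j n m : ℕ) (A : MvPowerSeries (Fin 2) ℚ) :
    coeffZW n m (varZ ^ k * varW ^ j * A) =
      if k ≤ n ∧ j ≤ m then coeffZW (n - k) (m - j) A else 0 := by
  rw [varZ_pow_mul_varW_pow, coeffZW_eq, MvPowerSeries.coeff_monomial_mul, expZW_sub, one_mul]
  simp only [expZW_le_iff, coeffZW_eq]

theorem coeffZW_exp (n m : ℕ) :
    coeffZW n m (PowerSeries.subst varZ (PowerSeries.exp ℚ)) =
      if m = 0 then (n ! : ℚ)⁻¹ else 0 := by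
  rw [coeffZW_eq, varZ, PowerSeries.coeff_subst (PowerSeries.HasSubst.X 0),
    finsum_eq_single _ n]
  · rw [MvPowerSeries.coeff_X_pow, PowerSeries.coeff_exp]
    have : expZW n m = Finsupp.single 0 n ↔ m = 0 := by
      constructor
      · intro h
        simpa using DFunLike.congr_fun h 1
      · rintro rfl
        simp [expZW]
    simp [this]
  · intro d hd
    rw [MvPowerSeries.coeff_X_pow, if_neg, smul_zero]
    intro h
    exact hd (by simpa using (DFunLike.congr_fun h 0).symm)

theorem coeffZW_exp_mul_pow (n m M : ℕ) :
    coeffZW n m (PowerSeries.subst varZ (PowerSeries.exp ℚ) * (1 + varW) ^ M) =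
      (n ! : ℚ)⁻¹ * (M.choose m : ℚ) := by
  have h : PowerSeries.subst varZ (PowerSeries.exp ℚ) * (1 + varW) ^ M =
      ∑ i ∈ Finset.range (M + 1), (M.choose i : ℚ) •
        (varZ ^ 0 * varW ^ i * PowerSeries.subst varZ (PowerSeries.exp ℚ)) := by
    rw [add_comm, add_pow, Finset.mul_sum]
    refine Finset.sum_congr rfl fun i _ => ?_
    rw [Algebra.smul_def, map_natCast]
    ring
  have h2 : ∀ i, coeffZW n m ((M.choose i : ℚ) •
        (varZ ^ 0 * varW ^ i * PowerSeries.subst varZ (PowerSeries.exp ℚ))) =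
      if i = m then (n ! : ℚ)⁻¹ * (M.choose m : ℚ) else 0 := by
    intro i
    have : ∀ (c : ℚ) A, coeffZW n m (c • A) = c * coeffZW n m A := fun c A => by
      simp [coeffZW]
    rw [this, coeffZW_pow_mul, coeffZW_exp]
    split_ifs <;> first | omega | skip
    · subst_vars; simp [mul_comm]
    all_goals simp
  have hs : coeffZW n m (∑ i ∈ Finset.range (M + 1), (M.choose i : ℚ) •
        (varZ ^ 0 * varW ^ i * PowerSeries.subst varZ (PowerSeries.exp ℚ))) =
      ∑ i ∈ Finset.range (M + 1), coeffZW n m ((M.choose i : ℚ) •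
        (varZ ^ 0 * varW ^ i * PowerSeries.subst varZ (PowerSeries.exp ℚ))) := map_sum _ _ _
  rw [h, hs, Finset.sum_congr rfl fun i _ => h2 i, Finset.sum_ite_eq']
  split_ifs with hm
  · rfl
  · rw [Nat.choose_eq_zero_of_lt (by simpa [Nat.lt_succ_iff] using hm)]
    simp

/-- The part of the generating series of degree at most `n` in `z`. -/
noncomputable def truncSeries (𝓕 : GraphFamily) (n : ℕ) : MvPowerSeries (Fin 2) ℚ :=
  ∑ k ∈ Finset.range (n + 1), ∑ j ∈ Finset.range (n.choose 2 + 1),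
    MvPowerSeries.monomial (expZW k j) ((familyCount 𝓕 k j : ℚ) / (k ! : ℚ))

/-- This reduces the substitution into an infinite series to one into a polynomial. Cutting off `j`
loses nothing, because a graph on $k\le n$ vertices has at most $\binom n2$ edges. -/
theorem varZ_pow_dvd (𝓕 : GraphFamily) (n : ℕ) :
    varZ ^ (n + 1) ∣ genSeries 𝓕 - truncSeries 𝓕 n := by
  classical
  rw [varZ, MvPowerSeries.X_pow_dvd_iff]
  intro d hd
  rw [map_sub, sub_eq_zero, truncSeries, map_sum, Finset.sum_eq_single (d 0)]
  · rw [map_sum, Finset.sum_eq_single (d 1)]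
    · rw [expZW_apply_eq, MvPowerSeries.coeff_monomial_same]
      rfl
    · intro j _ hj
      rw [MvPowerSeries.coeff_monomial, if_neg]
      intro h
      exact hj (by rw [h, expZW_one])
    · intro h
      have : (d 0).choose 2 ≤ n.choose 2 := Nat.choose_le_choose 2 (by omega)
      rw [familyCount_eq_zero 𝓕 (by rw [Finset.mem_range] at h; omega)]
      simp
  · intro k _ hk
    rw [map_sum]
    refine Finset.sum_eq_zero fun j _ => ?_
    rw [MvPowerSeries.coeff_monomial, if_neg]
    intro h
    exact hk (by rw [h, expZW_zero])
  · intro h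
    exact absurd (Finset.mem_range.2 hd) h

theorem coeffZW_distinguishedSeries (𝓕 : GraphFamily) (n m : ℕ) :
    coeffZW n m (distinguishedSeries 𝓕 (n.choose 2)) =
      ∑ k ∈ Finset.range (n + 1), ∑ j ∈ Finset.range (n.choose 2 + 1),
        (familyCount 𝓕 k j : ℚ) / (k ! : ℚ) *
          (((n - k)! : ℚ)⁻¹ * extensionCount (n.choose 2) m j) := by
  set N := n.choose 2 with hN
  have hS := hasSubst_varZ_varW
  obtain ⟨Q, hQ⟩ := varZ_pow_dvd 𝓕 n
  rw [sub_eq_iff_eq_add] at hQ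
  set Φ := MvPowerSeries.substAlgHom (R := ℚ) hS with hΦ
  have hz : Φ varZ = varZ :=
    MvPowerSeries.substAlgHom_X hS 0
  set E := PowerSeries.subst varZ (PowerSeries.exp ℚ) with hE
  have hinv : (1 + varW) * (1 + varW)⁻¹ = 1 :=
    MvPowerSeries.mul_inv_cancel _ (by simp [varW])
  have hterm : ∀ k, ∀ j ∈ Finset.range (N + 1),
      Φ (MvPowerSeries.monomial (expZW k j) ((familyCount 𝓕 k j : ℚ) / (k ! : ℚ))) *
        (E * (1 + varW) ^ N) =
      ((familyCount 𝓕 k j : ℚ) / (k ! : ℚ)) •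
        (varZ ^ k * varW ^ j * (E * (1 + varW) ^ (N - j))) := by
    intro k j hj
    have hj : j ≤ N := by rw [Finset.mem_range] at hj; omega
    rw [hΦ, MvPowerSeries.substAlgHom_monomial, Finsupp.prod_fintype _ _ (by simp),
      Fin.prod_univ_two, Algebra.smul_def]
    obtain ⟨r, hr⟩ := Nat.exists_eq_add_of_le hj
    have : (varW * (1 + varW)⁻¹) ^ j * (1 + varW) ^ N = varW ^ j * (1 + varW) ^ (N - j) := by
      rw [hr, Nat.add_sub_cancel_left, mul_pow, pow_add, mul_assoc, ← mul_assoc (_⁻¹ ^ j),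
        ← mul_pow, mul_comm _⁻¹, hinv, one_pow, one_mul]
    simp only [expZW_zero, expZW_one, Matrix.cons_val_zero, Matrix.cons_val_one]
    calc _ = algebraMap ℚ _ ((familyCount 𝓕 k j : ℚ) / (k ! : ℚ)) * (varZ ^ k * E *
        ((varW * (1 + varW)⁻¹) ^ j * (1 + varW) ^ N)) := by ring
      _ = _ := by rw [this]; ring
  -- The substitution fixes $z$, so the remainder stays divisible by $z^{n+1}$ and does not
  -- contribute to $[z^n]$.
  have hD : distinguishedSeries 𝓕 N =
      varZ ^ (n + 1) * varW ^ 0 * (Φ Q * (E * (1 + varW) ^ N)) +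
      ∑ k ∈ Finset.range (n + 1), ∑ j ∈ Finset.range (N + 1),
        ((familyCount 𝓕 k j : ℚ) / (k ! : ℚ)) •
        (varZ ^ k * varW ^ j * (E * (1 + varW) ^ (N - j))) := by
    rw [distinguishedSeries, ← MvPowerSeries.coe_substAlgHom hS, ← hΦ, ← hE, hQ, map_add, map_mul,
      map_pow, hz, truncSeries, map_sum, mul_assoc, add_mul, Finset.sum_mul]
    congr 1
    · ring
    · refine Finset.sum_congr rfl fun k _ => ?_
      rw [map_sum, Finset.sum_mul]
      exact Finset.sum_congr rfl fun j hj => hterm k j hj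
  have hc : ∀ k ∈ Finset.range (n + 1), ∀ j,
      coeffZW n m (((familyCount 𝓕 k j : ℚ) / (k ! : ℚ)) •
        (varZ ^ k * varW ^ j * (E * (1 + varW) ^ (N - j)))) =
      (familyCount 𝓕 k j : ℚ) / (k ! : ℚ) *
          (((n - k)! : ℚ)⁻¹ * extensionCount N m j) := by
    intro k hk j
    have hk : k ≤ n := by rw [Finset.mem_range] at hk; omega
    have : ∀ (c : ℚ) A, coeffZW n m (c • A) = c * coeffZW n m A := fun c A => by
      simp [coeffZW]
    rw [this, coeffZW_pow_mul, coeffZW_exp_mul_pow, extensionCount]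
    by_cases h : j ≤ m <;> simp [hk, h]
  let Ψ := MvPowerSeries.coeff (R := ℚ) (expZW n m)
  have hΨ : ∀ A, coeffZW n m A = Ψ A := fun _ => rfl
  rw [hD, hΨ, map_add, ← hΨ, coeffZW_pow_mul, if_neg (by omega), zero_add, map_sum]
  refine Finset.sum_congr rfl fun k hk => ?_
  rw [map_sum]
  exact Finset.sum_congr rfl fun j _ => hc k hk j

theorem distinguishedCount_eq_coeffZW (𝓕 : GraphFamily) (n m : ℕ) :
    (distinguishedCount 𝓕 n m : ℚ) =
      (n ! : ℚ) * coeffZW n m (distinguishedSeries 𝓕 (n.choose 2)) := by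
  rw [coeffZW_distinguishedSeries, distinguishedCount_eq_sum]
  push_cast
  simp only [Finset.mul_sum]
  refine Finset.sum_congr rfl fun k hk => Finset.sum_congr rfl fun j _ => ?_
  have hk : k ≤ n := by rw [Finset.mem_range] at hk; omega
  rw [Nat.cast_choose ℚ hk]
  field_simp

/-! ### Estimates for falling factorials and extension counts -/

/-- Falling factorials are close to powers. -/
theorem one_sub_mul_pow_le_descFactorial (n k : ℕ) (hn : 0 < n) :
    (1 - (k : ℝ) ^ 2 / n) * (n : ℝ) ^ k ≤ (n.descFactorial k : ℝ) := by
  have hn' : (0 : ℝ) < n := by exact_mod_cast hn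
  induction k with
  | zero => simp
  | succ k ih =>
    -- For $k\ge n$ the left side is nonpositive; otherwise $(n-k)(1-k^2/n)\ge n-(k+1)^2$ carries
    -- the induction.
    by_cases hk : n ≤ k
    · refine (mul_nonpos_of_nonpos_of_nonneg ?_ (by positivity)).trans (by positivity)
      rw [sub_nonpos, one_le_div hn']
      have : (n : ℝ) ≤ k := by exact_mod_cast hk
      push_cast
      nlinarith [(Nat.cast_nonneg k : (0 : ℝ) ≤ k)]
    · have hk : k ≤ n := by omega
      rw [Nat.descFactorial_succ]
      push_cast [Nat.cast_sub hk]
      have hnk : (0 : ℝ) ≤ (n : ℝ) - k := by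
        rw [sub_nonneg]; exact_mod_cast hk
      refine le_trans ?_ (mul_le_mul_of_nonneg_left ih hnk)
      rw [pow_succ (n : ℝ), mul_comm ((n : ℝ) ^ k), ← mul_assoc, ← mul_assoc]
      refine mul_le_mul_of_nonneg_right ?_ (by positivity)
      have : ((n : ℝ) - k) * (1 - (k : ℝ) ^ 2 / n) =
          n - k - (k : ℝ) ^ 2 + (k : ℝ) ^ 3 / n := by field_simp; ring
      have h2 : (1 - ((k : ℝ) + 1) ^ 2 / n) * n = n - (k + 1) ^ 2 := by field_simp
      rw [this, h2]
      have : (0 : ℝ) ≤ (k : ℝ) ^ 3 / n := by positivity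
      nlinarith [(Nat.cast_nonneg k : (0 : ℝ) ≤ k)]

/-- Quadratic errors are absorbed into powers of two, that is, into a rescaling of the arguments of
$F$. The case $k=3$ is why a constant above 1 is needed. -/
theorem sq_le_two_mul_two_pow (k : ℕ) : k ^ 2 ≤ 2 * 2 ^ k := by
  by_cases h : k < 4
  · interval_cases k <;> norm_num
  · induction k, (not_lt.1 h) using Nat.le_induction with
    | base => norm_num
    | succ k hk ih =>
      have := ih (by omega)
      rw [pow_succ 2]
      nlinarith

/-- Both sides are $j!$ times the number of $m$-subsets of an $N$-set with a marked $j$-subset; both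
vanish for $j>m$. -/
theorem extensionCount_mul_descFactorial (N m j : ℕ) :
    extensionCount N m j * N.descFactorial j = N.choose m * m.descFactorial j := by
  unfold extensionCount
  split_ifs with h
  · rw [Nat.descFactorial_eq_factorial_mul_choose, Nat.descFactorial_eq_factorial_mul_choose]
    have := Nat.choose_mul (n := N) (k := m) (s := j) h
    calc _ = j ! * (N.choose j * (N - j).choose (m - j)) := by ring
      _ = _ := by rw [← this]; ring
  · rw [Nat.descFactorial_eq_zero_iff_lt.2 (not_le.1 h)]
    simp

/-- Consecutive values have ratio $(m-j)/(N-j)\le m/N$, as $m\le N$. -/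
theorem extensionCount_le {N m j : ℕ} (hmN : m ≤ N) (hN : 0 < N) :
    (extensionCount N m j : ℝ) ≤ N.choose m * ((m : ℝ) / N) ^ j := by
  have hN' : (0 : ℝ) < N := by exact_mod_cast hN
  induction j with
  | zero => simp [extensionCount]
  | succ j ih =>
    by_cases hj : j + 1 ≤ m
    · have h1 := extensionCount_mul_descFactorial N m j
      have h2 := extensionCount_mul_descFactorial N m (j + 1)
      have hd : 0 < N.descFactorial j := Nat.descFactorial_pos.2 (by omega)
      have h3 : extensionCount N m (j + 1) * (N - j) = extensionCount N m j * (m - j) := by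
        refine Nat.eq_of_mul_eq_mul_right hd ?_
        rw [Nat.descFactorial_succ, Nat.descFactorial_succ] at h2
        calc _ = extensionCount N m (j + 1) * ((N - j) * N.descFactorial j) := by ring
          _ = _ := by rw [h2]
          _ = (m - j) * (N.choose m * m.descFactorial j) := by ring
          _ = _ := by rw [← h1]; ring
      have h4 : (extensionCount N m (j + 1) : ℝ) * (N - j) = extensionCount N m j * (m - j) := by
        rw [← Nat.cast_sub (by omega), ← Nat.cast_sub (by omega)]
        exact_mod_cast h3
      have hjm : (j : ℝ) + 1 ≤ m := by exact_mod_cast hj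
      have hmN' : (m : ℝ) ≤ N := by exact_mod_cast hmN
      have hle : ((m : ℝ) - j) / (N - j) ≤ m / N := by
        rw [div_le_div_iff₀ (by linarith) hN']
        nlinarith [(Nat.cast_nonneg j : (0 : ℝ) ≤ j)]
      have h5 : (extensionCount N m (j + 1) : ℝ) =
          extensionCount N m j * (((m : ℝ) - j) / (N - j)) := by
        rw [← mul_div_assoc, eq_div_iff (by linarith), h4]
      rw [h5, pow_succ, ← mul_assoc]
      exact mul_le_mul ih hle (div_nonneg (by linarith) (by linarith)) (by positivity)
    · rw [extensionCount, if_neg hj]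
      push_cast
      positivity

theorem le_extensionCount {N m j : ℕ} (hmN : m ≤ N) (hm : 0 < m) :
    (N.choose m : ℝ) * ((m : ℝ) / N) ^ j * (1 - (j : ℝ) ^ 2 / m) ≤ extensionCount N m j := by
  have hN : (0 : ℝ) < N := by exact_mod_cast hm.trans_le hmN
  have h1 : (extensionCount N m j : ℝ) * N.descFactorial j = N.choose m * m.descFactorial j := by
    exact_mod_cast extensionCount_mul_descFactorial N m j
  have h2 := one_sub_mul_pow_le_descFactorial m j hm
  have h3 : (N.descFactorial j : ℝ) ≤ (N : ℝ) ^ j := by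
    exact_mod_cast Nat.descFactorial_le_pow N j
  have h4 : (0 : ℝ) < (N : ℝ) ^ j := by positivity
  refine le_of_mul_le_mul_right ?_ h4
  calc _ = (N.choose m : ℝ) * ((1 - (j : ℝ) ^ 2 / m) * (m : ℝ) ^ j) := by
        rw [div_pow]; field_simp
    _ ≤ N.choose m * m.descFactorial j := by gcongr
    _ = extensionCount N m j * N.descFactorial j := h1.symm
    _ ≤ _ := by gcongr

/-! ### Termwise comparison with the generating function -/

/-- The terms of the generating function at real arguments. -/
noncomputable def realTerm (𝓕 : GraphFamily) (z w : ℝ) (p : ℕ × ℕ) : ℝ :=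
  (familyCount 𝓕 p.1 p.2 : ℝ) * w ^ p.2 * (z ^ p.1 / (p.1 ! : ℝ))

theorem ofReal_realTerm (𝓕 : GraphFamily) (z w : ℝ) (p : ℕ × ℕ) :
    ((realTerm 𝓕 z w p : ℝ) : ℂ) = genTerm 𝓕 z w p := by
  simp [realTerm, genTerm]

theorem genFun_ofReal (𝓕 : GraphFamily) (z w : ℝ) :
    genFun 𝓕 z w = ((∑' p, realTerm 𝓕 z w p : ℝ) : ℂ) := by
  rw [Complex.ofReal_tsum]
  exact tsum_congr fun p => (ofReal_realTerm 𝓕 z w p).symm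

theorem summable_realTerm {𝓕 : GraphFamily} (h : IsEntire 𝓕) (z w : ℝ) :
    Summable (realTerm 𝓕 z w) := by
  rw [← Complex.summable_ofReal]
  simpa only [ofReal_realTerm] using h z w

theorem realTerm_nonneg (𝓕 : GraphFamily) {z w : ℝ} (hz : 0 ≤ z) (hw : 0 ≤ w) (p : ℕ × ℕ) :
    0 ≤ realTerm 𝓕 z w p := by
  unfold realTerm
  positivity

theorem realTerm_two_mul (𝓕 : GraphFamily) (z w : ℝ) (p : ℕ × ℕ) :
    realTerm 𝓕 (z * 2) (w * 2) p = realTerm 𝓕 z w p * (2 ^ p.1 * 2 ^ p.2) := by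
  unfold realTerm
  rw [mul_pow, mul_pow]
  ring

/-- The number of distinguished pairs with given vertex set size and edge number. -/
noncomputable def pairCount (𝓕 : GraphFamily) (n m : ℕ) (p : ℕ × ℕ) : ℕ :=
  n.choose p.1 * (familyCount 𝓕 p.1 p.2 * extensionCount (n.choose 2) m p.2)

theorem pairCount_le (𝓕 : GraphFamily) {n m : ℕ} (hm : 0 < m) (hmN : m ≤ n.choose 2)
    (p : ℕ × ℕ) :
    (pairCount 𝓕 n m p : ℝ) ≤
      (n.choose 2).choose m * realTerm 𝓕 n ((m : ℝ) / (n.choose 2 : ℕ)) p := by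
  have h1 := extensionCount_le (j := p.2) hmN (hm.trans_le hmN)
  have h2 : (n.choose p.1 : ℝ) ≤ (n : ℝ) ^ p.1 / p.1 ! := Nat.choose_le_pow_div p.1 n
  calc (pairCount 𝓕 n m p : ℝ) =
      n.choose p.1 * (familyCount 𝓕 p.1 p.2 * extensionCount (n.choose 2) m p.2) := by
        unfold pairCount; push_cast; rfl
    _ ≤ ((n : ℝ) ^ p.1 / p.1 !) * (familyCount 𝓕 p.1 p.2 *
        ((n.choose 2).choose m * ((m : ℝ) / (n.choose 2 : ℕ)) ^ p.2)) := by gcongr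
    _ = _ := by unfold realTerm; ring

theorem le_pairCount (𝓕 : GraphFamily) {n m : ℕ} (hn : 0 < n) (hm : 0 < m)
    (hmN : m ≤ n.choose 2) (p : ℕ × ℕ) :
    (n.choose 2).choose m * realTerm 𝓕 n ((m : ℝ) / (n.choose 2 : ℕ)) p -
      pairCount 𝓕 n m p ≤ (n.choose 2).choose m *
        ((2 / n + 2 / m) * realTerm 𝓕 (n * 2) ((m : ℝ) / (n.choose 2 : ℕ) * 2) p) := by
  set t := realTerm 𝓕 n ((m : ℝ) / (n.choose 2 : ℕ)) p with ht
  have ht0 : 0 ≤ t := realTerm_nonneg 𝓕 (by positivity) (by positivity) p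
  rw [realTerm_two_mul, ← ht]
  set B : ℝ := (((n.choose 2).choose m : ℕ) : ℝ) with hB
  have hn' : (0 : ℝ) < n := by exact_mod_cast hn
  have hm' : (0 : ℝ) < m := by exact_mod_cast hm
  set a : ℝ := (p.1 : ℝ) ^ 2 / n with ha
  set b : ℝ := (p.2 : ℝ) ^ 2 / m with hb
  have ha0 : 0 ≤ a := by positivity
  have hb0 : 0 ≤ b := by positivity
  have key : B * t * (1 - a - b) ≤ pairCount 𝓕 n m p := by
    -- Multiplying the lower bounds with factors $1-a$ and $1-b$ needs both to be nonnegative;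
    -- otherwise $1-a-b\le 0$ and the claim is trivial.
    by_cases hab : a ≤ 1 ∧ b ≤ 1
    · have h1 := le_extensionCount (j := p.2) hmN hm
      have h2 : (1 - a) * ((n : ℝ) ^ p.1 / p.1 !) ≤ n.choose p.1 := by
        rw [← mul_div_assoc, div_le_iff₀ (by positivity)]
        refine (one_sub_mul_pow_le_descFactorial n p.1 hn).trans (le_of_eq ?_)
        rw [Nat.descFactorial_eq_factorial_mul_choose]
        push_cast
        ring
      have hb1 : 0 ≤ 1 - b := sub_nonneg.2 hab.2
      have ha1 : 0 ≤ 1 - a := sub_nonneg.2 hab.1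
      calc B * t * (1 - a - b) ≤ B * t * ((1 - a) * (1 - b)) := by
            gcongr
            nlinarith
        _ = ((1 - a) * ((n : ℝ) ^ p.1 / p.1 !)) * (familyCount 𝓕 p.1 p.2 *
            (B * ((m : ℝ) / (n.choose 2 : ℕ)) ^ p.2 * (1 - b))) := by
            rw [ht]; unfold realTerm; ring
        _ ≤ n.choose p.1 * (familyCount 𝓕 p.1 p.2 * extensionCount (n.choose 2) m p.2) := by
            gcongr
        _ = _ := by unfold pairCount; push_cast; rfl
    · refine (mul_nonpos_of_nonneg_of_nonpos (by positivity) ?_).trans (Nat.cast_nonneg _)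
      by_contra hneg
      exact hab ⟨by linarith, by linarith⟩
  have h2 : a + b ≤ (2 / n + 2 / m) * (2 ^ p.1 * 2 ^ p.2) := by
    have hk : ((p.1 : ℝ)) ^ 2 ≤ 2 * (2 ^ p.1 * 2 ^ p.2) := by
      have h := sq_le_two_mul_two_pow p.1
      have h' : ((p.1 : ℝ)) ^ 2 ≤ 2 * 2 ^ p.1 := by exact_mod_cast h
      exact h'.trans (mul_le_mul_of_nonneg_left
        (le_mul_of_one_le_right (by positivity) (one_le_pow₀ (by norm_num))) (by norm_num))
    have hj : ((p.2 : ℝ)) ^ 2 ≤ 2 * (2 ^ p.1 * 2 ^ p.2) := by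
      have h := sq_le_two_mul_two_pow p.2
      have h' : ((p.2 : ℝ)) ^ 2 ≤ 2 * 2 ^ p.2 := by exact_mod_cast h
      exact h'.trans (mul_le_mul_of_nonneg_left
        (le_mul_of_one_le_left (by positivity) (one_le_pow₀ (by norm_num))) (by norm_num))
    calc a + b ≤ 2 * (2 ^ p.1 * 2 ^ p.2) / n + 2 * (2 ^ p.1 * 2 ^ p.2) / m := by
          rw [ha, hb]; gcongr
      _ = _ := by ring
  have h3 : B * t * (a + b) ≤ B * t * ((2 / n + 2 / m) * (2 ^ p.1 * 2 ^ p.2)) := by gcongr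
  calc _ ≤ B * t * (a + b) := by linarith
    _ ≤ _ := h3
    _ = _ := by ring

theorem hasSum_pairCount (𝓕 : GraphFamily) {n m : ℕ} (hmN : m ≤ n.choose 2) :
    HasSum (fun p => (pairCount 𝓕 n m p : ℝ)) (distinguishedCount 𝓕 n m) := by
  have h : (distinguishedCount 𝓕 n m : ℝ) =
      ∑ p ∈ Finset.range (n + 1) ×ˢ Finset.range (n.choose 2 + 1), (pairCount 𝓕 n m p : ℝ) := by
    rw [distinguishedCount_eq_sum, Finset.sum_product]
    push_cast [pairCount]
    rfl
  rw [h]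
  refine hasSum_sum_of_ne_finset_zero fun p hp => ?_
  rw [Finset.mem_product, Finset.mem_range, Finset.mem_range, not_and_or] at hp
  rcases hp with hp | hp
  · simp [pairCount, Nat.choose_eq_zero_of_lt (show n < p.1 by omega)]
  -- Here $j>\binom n2\ge m$, so no $m$-edge graph contains the subgraph.
  · have : ¬ p.2 ≤ m := by omega
    simp [pairCount, extensionCount, this]

/-! ### The asymptotic equivalence -/

/-- Quantitative comparison of the number of distinguished pairs with the first moment value. -/
theorem norm_distinguishedCount_sub_le {𝓕 : GraphFamily} (hF : IsEntire 𝓕) {n m : ℕ}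
    (hn : 0 < n) (hm : 0 < m) (hmN : m ≤ n.choose 2) :
    ‖(distinguishedCount 𝓕 n m : ℂ) -
        ((n.choose 2).choose m : ℂ) * genFun 𝓕 n (edgeRatio n m)‖ ≤
      (2 / n + 2 / m) * ‖rescaledRatio 𝓕 n m (2, 2)‖ *
        ‖((n.choose 2).choose m : ℂ) * genFun 𝓕 n (edgeRatio n m)‖ := by
  set B : ℝ := (((n.choose 2).choose m : ℕ) : ℝ) with hB
  set x : ℝ := (m : ℝ) / (n.choose 2 : ℕ) with hx
  have hx0 : 0 ≤ x := by positivity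
  set s : ℝ := ∑' p, realTerm 𝓕 n x p with hs
  set s2 : ℝ := ∑' p, realTerm 𝓕 (n * 2) (x * 2) p with hs2
  have he : edgeRatio n m = (x : ℂ) := by simp [edgeRatio, hx]
  have hg : genFun 𝓕 n (edgeRatio n m) = (s : ℂ) := by
    rw [he, ← Complex.ofReal_natCast, genFun_ofReal]
  have hg2 : genFun 𝓕 (n * 2) (edgeRatio n m * 2) = (s2 : ℂ) := by
    rw [he, hs2, ← genFun_ofReal]
    push_cast
    rfl
  have hnn : ∀ p, 0 ≤ realTerm 𝓕 n x p := realTerm_nonneg 𝓕 (by positivity) hx0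
  have hsum := summable_realTerm hF n x
  have hs0 : 0 ≤ s := tsum_nonneg hnn
  have hs20 : 0 ≤ s2 := tsum_nonneg (realTerm_nonneg 𝓕 (by positivity) (by positivity))
  have hR : ‖rescaledRatio 𝓕 n m (2, 2)‖ * s = s2 := by
    rw [rescaledRatio, hg, hg2, norm_div, Complex.norm_real, Complex.norm_real,
      Real.norm_of_nonneg hs0, Real.norm_of_nonneg hs20]
    -- If $F(n,m/N)=0$ the ratio is the default value of division by zero; but then all its
    -- nonnegative terms vanish, hence so does $F(2n,2m/N)$.
    by_cases h : s = 0
    · have h0 : ∀ p, realTerm 𝓕 n x p = 0 := by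
        have h' := hsum.hasSum
        rw [← hs, h] at h'
        exact congrFun ((hasSum_zero_iff_of_nonneg hnn).1 h')
      have : s2 = 0 := by
        rw [hs2]
        simp_rw [realTerm_two_mul, h0]
        simp
      rw [this, h, mul_zero]
    · field_simp
  have hd := hasSum_pairCount 𝓕 (n := n) hmN
  have hBs : HasSum (fun p => B * realTerm 𝓕 n x p) (B * s) := hsum.hasSum.mul_left B
  have hup : (distinguishedCount 𝓕 n m : ℝ) ≤ B * s :=
    hasSum_le (fun p => pairCount_le 𝓕 hm hmN p) hd hBs
  have hlow : B * s - distinguishedCount 𝓕 n m ≤ B * ((2 / n + 2 / m) * s2) :=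
    hasSum_le (fun p => le_pairCount 𝓕 hn hm hmN p) (hBs.sub hd)
      (((summable_realTerm hF (n * 2) (x * 2)).hasSum.mul_left _).mul_left B)
  have hc : (distinguishedCount 𝓕 n m : ℂ) - ((n.choose 2).choose m : ℂ) * (s : ℂ) =
      (((distinguishedCount 𝓕 n m : ℝ) - B * s : ℝ) : ℂ) := by
    push_cast [hB]
    rfl
  have hc2 : ((n.choose 2).choose m : ℂ) * (s : ℂ) = ((B * s : ℝ) : ℂ) := by
    push_cast [hB]
    rfl
  rw [hg, hc, hc2, Complex.norm_real, Complex.norm_real, Real.norm_of_nonpos (by linarith),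
    Real.norm_of_nonneg (by positivity)]
  calc _ = B * s - distinguishedCount 𝓕 n m := by ring
    _ ≤ _ := hlow
    _ = _ := by rw [← hR]; ring

theorem eventually_le_choose_two {m : ℕ → ℕ}
    (h : (fun n : ℕ => (m n : ℝ)) =o[atTop] (fun n : ℕ => (n : ℝ) ^ 2)) :
    ∀ᶠ n in atTop, m n ≤ n.choose 2 := by
  -- The constant $1/4$ works because $n^2/4\le n(n-1)/2$ for $n\ge2$.
  filter_upwards [h.bound (show (0 : ℝ) < 1 / 4 by norm_num), eventually_ge_atTop 2] with n hn h2
  rw [Real.norm_of_nonneg (by positivity), Real.norm_of_nonneg (by positivity)] at hn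
  have h2' : (2 : ℝ) ≤ n := by exact_mod_cast h2
  have : (m n : ℝ) ≤ (n.choose 2 : ℕ) := by
    rw [Nat.cast_choose_two]
    nlinarith
  exact_mod_cast this

theorem distinguishedCount_isEquivalent {𝓕 : GraphFamily} {m : ℕ → ℕ} (hF : IsEntire 𝓕)
    (hm : Tendsto m atTop atTop)
    (hmo : (fun n : ℕ => (m n : ℝ)) =o[atTop] (fun n : ℕ => (n : ℝ) ^ 2)) {l : ℂ}
    (hl : Tendsto (fun n => rescaledRatio 𝓕 n (m n) (2, 2)) atTop (nhds l)) :
    (fun n : ℕ => (distinguishedCount 𝓕 n (m n) : ℂ)) ~[atTop]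
      (fun n : ℕ => ((n.choose 2).choose (m n) : ℂ) * genFun 𝓕 (n : ℂ) (edgeRatio n (m n))) := by
  have h0 : Tendsto (fun n : ℕ => ((2 : ℝ) / n + 2 / (m n : ℕ)) *
      ‖rescaledRatio 𝓕 n (m n) (2, 2)‖) atTop (nhds 0) := by
    have h1 : Tendsto (fun n : ℕ => (2 : ℝ) / n) atTop (nhds 0) :=
      tendsto_const_div_atTop_nhds_zero_nat 2
    simpa using (h1.add (h1.comp hm)).mul hl.norm
  rw [IsEquivalent, isLittleO_iff]
  intro c hc
  filter_upwards [h0.eventually_le_const hc, eventually_le_choose_two hmo,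
    eventually_gt_atTop 0, hm.eventually_gt_atTop 0] with n h1 h2 h3 h4
  exact (norm_distinguishedCount_sub_le hF h3 h4 h2).trans
    (mul_le_mul_of_nonneg_right h1 (norm_nonneg _))

end SubgraphCount

theorem mainTheorem3 (𝓕 : SubgraphCount.GraphFamily) :
    (∀ n m : ℕ,
      (SubgraphCount.distinguishedCount 𝓕 n m : ℚ) =
        (n ! : ℚ) *
          SubgraphCount.coeffZW n m (SubgraphCount.distinguishedSeries 𝓕 (n.choose 2))) ∧
    (∀ m : ℕ → ℕ,
      SubgraphCount.IsEntire 𝓕 →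
      Tendsto m atTop atTop →
      (fun n : ℕ => (m n : ℝ)) =o[atTop] (fun n : ℕ => (n : ℝ) ^ 2) →
      (∃ L : ℂ × ℂ → ℂ, AnalyticOnNhd ℂ L Set.univ ∧
        ∀ K : Set (ℂ × ℂ), IsCompact K →
          TendstoUniformlyOn (fun n : ℕ => SubgraphCount.rescaledRatio 𝓕 n (m n)) L atTop K) →
      (fun n : ℕ => (SubgraphCount.distinguishedCount 𝓕 n (m n) : ℂ)) ~[atTop]
        (fun n : ℕ => ((n.choose 2).choose (m n) : ℂ) *
          SubgraphCount.genFun 𝓕 (n : ℂ) (SubgraphCount.edgeRatio n (m n)))) := by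
  refine ⟨SubgraphCount.distinguishedCount_eq_coeffZW 𝓕, ?_⟩
  rintro m hF hm hmo ⟨L, -, hL⟩
  exact SubgraphCount.distinguishedCount_isEquivalent hF hm hmo
    ((hL {(2, 2)} isCompact_singleton).tendsto_at (Set.mem_singleton _))
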